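/- Let $k$ be a field, and let $A=k[x,y]$ be the polynomial ring in two variables over $k$. For each integer $n\ge 1$, let \[ B_n=A\left[\frac{x-1}{x^ny-1}\right] \] be the $A$-subalgebra of the field of fractions $k(x,y)$ of $A$ generated by $(x-1)/(x^ny-1)$. For a ring $R$ and an integer $d\ge 1$, let $R^{[d]}$ denote the polynomial ring in $d$ variables over $R$. Let $m,n,d\ge 1$ be integers. If $B_m^{[d]}$ and $B_n^{[d]}$ are isomorphic as $k$-algebras, then $m=n$. -/

import Mathlib

namespace AffineModification

noncomputable section

/-- The polynomial ring `A = k[x, y]` in two variables, with `x = X 0` and `y = X 1`. -/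
abbrev A (k : Type*) [Field k] : Type _ := MvPolynomial (Fin 2) k

/-- The element `u = (x - 1) / (x ^ n * y - 1)` of the field of fractions of `A = k[x, y]`. -/
def u (k : Type*) [Field k] (n : ℕ) : FractionRing (A k) :=
  algebraMap (A k) (FractionRing (A k)) (MvPolynomial.X 0 - 1) /
    algebraMap (A k) (FractionRing (A k)) (MvPolynomial.X 0 ^ n * MvPolynomial.X 1 - 1)

/-- The ring `B_n = A[(x - 1) / (x ^ n * y - 1)]`: the `A`-subalgebra generated by `u` in the
field of fractions of `A = k[x, y]`. -/
abbrev B (k : Type*) [Field k] (n : ℕ) : Subalgebra (A k) (FractionRing (A k)) :=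
  Algebra.adjoin (A k) {u k n}

/-- The denominator of `u` is not zero, so `u` is a genuine fraction. -/
theorem denominator_ne_zero (k : Type*) [Field k] (n : ℕ) :
    algebraMap (A k) (FractionRing (A k))
      (MvPolynomial.X 0 ^ n * MvPolynomial.X 1 - 1) ≠ 0 := by
  intro h
  have h1 := (map_eq_zero_iff _ (IsFractionRing.injective (A k) (FractionRing (A k)))).mp h
  have h2 := congrArg (MvPolynomial.eval (fun _ : Fin 2 => (0 : k))) h1
  simp at h2

end

end AffineModification

namespace AffineModification

open Polynomial

/-! ### Degree bounds from the defining relation -/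

section Degree

variable {D : Type*} [CommRing D] {deg : D → ℕ}

/-! Put v = x^n y - 1, so that u v = x - 1. If a map to a polynomial ring over a domain kills none
of x, y, v, u, uy - 1, comparing degrees in this relation makes the images of x, y, u constant
(`deg_eq_zero_of_rel`). For embeddings of B_n, this shows that an isomorphism of the polynomial
rings carries coefficients to coefficients, hence descends to B_m ≅ B_n (`nonempty_algEquiv`).

For maps to k[X], it says that every nonconstant polynomial curve in Spec B_n lies in the zero set
of one of the five elements, with uy - 1 superfluous when n ≥ 2. The other four cut out affine lines
forming the chain x, y, u, v, in which only neighbours meet. Units being constants, an isomorphism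
with n ≥ 2 sends these four elements to scalar multiples of their counterparts
(`exists_map_special_eq`), preserving or reversing the chain (`chain_rigid`). If it is preserved,
x^m and x^n agree up to a scalar, so m = n; if reversed, x^n and x do, contradicting n ≥ 2. By
symmetry only m = n = 1 remains. -/

theorem deg_pow [IsDomain D] (hmul : ∀ a b, a ≠ 0 → b ≠ 0 → deg (a * b) = deg a + deg b)
    (hone : deg 1 = 0) {a : D} (ha : a ≠ 0) (n : ℕ) : deg (a ^ n) = n * deg a := by
  induction n with
  | zero => simp [hone]
  | succ n ih => rw [pow_succ, hmul _ _ (pow_ne_zero _ ha) ha, ih]; ring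

theorem deg_sub_one (hsub : ∀ a b, deg (a - b) ≤ max (deg a) (deg b)) (hone : deg 1 = 0)
    (hzero : deg 0 = 0) (a : D) : deg (a - 1) = deg a := by
  have hneg (b : D) : deg (-b) ≤ deg b := by simpa [hzero] using hsub 0 b
  have h1 := hsub a 1
  have h2 := hsub (a - 1) (-1)
  have h3 := hneg 1
  rw [sub_neg_eq_add, sub_add_cancel] at h2
  omega

/-- For any degree function, a solution of `u (x ^ n y - 1) = x - 1` none of whose distinguished
elements vanishes is constant. -/
theorem deg_eq_zero_of_rel [IsDomain D]
    (hmul : ∀ a b, a ≠ 0 → b ≠ 0 → deg (a * b) = deg a + deg b)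
    (hsub : ∀ a b, deg (a - b) ≤ max (deg a) (deg b)) (hone : deg 1 = 0) (hzero : deg 0 = 0)
    {n : ℕ} (hn : 1 ≤ n) {x y u : D} (rel : u * (x ^ n * y - 1) = x - 1) (hx : x ≠ 0)
    (hy : y ≠ 0) (hu : u ≠ 0) (hv : x ^ n * y - 1 ≠ 0) (hw : u * y - 1 ≠ 0 ∨ 2 ≤ n) :
    deg x = 0 ∧ deg y = 0 ∧ deg u = 0 := by
  have hs := deg_sub_one hsub hone hzero
  have d1 : deg u + (n * deg x + deg y) = deg x := by
    have h := hs x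
    rwa [← rel, hmul _ _ hu hv, hs, hmul _ _ (pow_ne_zero _ hx) hy, deg_pow hmul hone hx] at h
  suffices h : deg x = 0 by
    rw [h] at d1
    omega
  by_contra h
  obtain rfl | hn2 := hn.eq_or_lt
  · replace hw := hw.resolve_right (by omega)
    -- For n = 1, `d1` gives deg u = 0 but leaves deg x free; this form of the relation bounds it by
    -- deg u.
    have hk : x * (u * y - 1) = u - 1 := by linear_combination rel
    have d2 := hmul _ _ hx hw
    rw [hk, hs] at d2
    omega
  · have : 2 * deg x ≤ n * deg x := Nat.mul_le_mul_right _ hn2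
    omega

end Degree

/-! ### Affine lines in the spectrum -/

/-- The properties of `B_n`, with its generators `x`, `y` and `u`, that determine `n`. -/
structure IsModification (k : Type*) [Field k] (n : ℕ) {R : Type*} [CommRing R] [Algebra k R]
    (x y u : R) : Prop where
  rel : u * (x ^ n * y - 1) = x - 1
  adjoin_eq_top : Algebra.adjoin k {x, y, u} = ⊤
  exists_hom : ∀ a b c : k[X], c * (a ^ n * b - 1) = a - 1 →
    ∃ h : R →ₐ[k] k[X], h x = a ∧ h y = b ∧ h u = c
  exists_eq_algebraMap : ∀ r : R, IsUnit r → ∃ c : k, r = algebraMap k R c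

/-- The distinguished elements: those cutting out the affine lines in the spectrum of `B_n`
(and, for `n ≥ 2`, one more). -/
def special {R : Type*} [CommRing R] (n : ℕ) (x y u : R) : Fin 5 → R :=
  ![x, y, x ^ n * y - 1, u, u * y - 1]

namespace IsModification

variable {k : Type*} [Field k] {n : ℕ} {R : Type*} [CommRing R] [Algebra k R] {x y u : R}

theorem mem_of_gens (M : IsModification k n x y u) (S : Subalgebra k R) (hx : x ∈ S) (hy : y ∈ S)
    (hu : u ∈ S) (r : R) : r ∈ S := by
  have h : Algebra.adjoin k {x, y, u} ≤ S := by
    rw [Algebra.adjoin_le_iff]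
    rintro _ (rfl | rfl | rfl) <;> assumption
  rw [M.adjoin_eq_top] at h
  exact h trivial

/-- Modulo p, the map h followed by X ↦ s agrees with the identity, since it does so on generators.
Hence the kernel of h lies in (p). -/
theorem dvd_sub (M : IsModification k n x y u) (h : R →ₐ[k] k[X]) (s p : R)
    (hx : p ∣ x - aeval s (h x)) (hy : p ∣ y - aeval s (h y)) (hu : p ∣ u - aeval s (h u))
    (r : R) : p ∣ r - aeval s (h r) := by
  let π := Ideal.Quotient.mkₐ k (Ideal.span {p})
  have key (r : R) : p ∣ r - aeval s (h r) ↔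
      r ∈ AlgHom.equalizer π (π.comp ((aeval s).comp h)) := by
    rw [AlgHom.mem_equalizer]
    simp only [π, AlgHom.comp_apply, Ideal.Quotient.mkₐ_eq_mk]
    rw [Ideal.Quotient.eq, Ideal.mem_span_singleton]
  rw [key] at *
  exact M.mem_of_gens _ hx hy hu r

theorem dvd_of_hom_eq_zero (M : IsModification k n x y u) (h : R →ₐ[k] k[X]) (s p : R)
    (hx : p ∣ x - aeval s (h x)) (hy : p ∣ y - aeval s (h y)) (hu : p ∣ u - aeval s (h u))
    (r : R) (hr : h r = 0) : p ∣ r := by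
  simpa [hr] using M.dvd_sub h s p hx hy hu r

/-- The affine line cut out by `special n x y u j`, parametrized. -/
structure IsLine (n : ℕ) (x y u : R) (j : Fin 5) (h : R →ₐ[k] k[X]) : Prop where
  nonconstant : ∃ r, (h r).natDegree ≠ 0
  dvd : ∀ r, h r = 0 → special n x y u j ∣ r
  eq_zero_iff : ∀ i, h (special n x y u i) = 0 ↔ i = j

theorem exists_line_zero (M : IsModification k n x y u) (hn : 1 ≤ n) :
    ∃ h : R →ₐ[k] k[X], IsLine n x y u 0 h := by
  have hX : (X : k[X]) - 1 ≠ 0 := X_sub_C_ne_zero (1 : k)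
  have hn0 : n ≠ 0 := by omega
  obtain ⟨h, h1, h2, h3⟩ := M.exists_hom 0 X 1 (by simp [hn0])
  refine ⟨h, ⟨y, by simp [h2]⟩, M.dvd_of_hom_eq_zero h y _ ?_ ?_ ?_, ?_⟩
  · simp [special, h1]
  · simp [special, h2]
  · rw [h3, map_one]
    refine ⟨x ^ (n - 1) * y * u - 1, ?_⟩
    have hp : x ^ n = x * x ^ (n - 1) := (mul_pow_sub_one hn0 x).symm
    change _ = x * _
    linear_combination -M.rel + u * y * hp
  · intro i; fin_cases i <;> simp [special, h1, h2, h3, hn0, hX]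

theorem exists_line_one (M : IsModification k n x y u) :
    ∃ h : R →ₐ[k] k[X], IsLine n x y u 1 h := by
  have hX : (1 : k[X]) - X ≠ 0 := by
    rw [← neg_sub]; exact neg_ne_zero.mpr (X_sub_C_ne_zero (1 : k))
  obtain ⟨h, h1, h2, h3⟩ := M.exists_hom (1 - X) 0 X (by ring)
  refine ⟨h, ⟨u, by simp [h3]⟩, M.dvd_of_hom_eq_zero h u _ ?_ ?_ ?_, ?_⟩
  · refine ⟨u * x ^ n, ?_⟩
    simp only [h1, map_sub, map_one, aeval_X]
    change _ = y * _
    linear_combination -M.rel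
  · simp [special, h2]
  · simp [h3]
  · intro i; fin_cases i <;> simp [special, h1, h2, h3, hX]

theorem exists_line_two (M : IsModification k n x y u) :
    ∃ h : R →ₐ[k] k[X], IsLine n x y u 2 h := by
  have hX : (X : k[X]) - 1 ≠ 0 := X_sub_C_ne_zero (1 : k)
  obtain ⟨h, h1, h2, h3⟩ := M.exists_hom 1 1 X (by simp)
  refine ⟨h, ⟨u, by simp [h3]⟩, M.dvd_of_hom_eq_zero h u _ ?_ ?_ ?_, ?_⟩
  · refine ⟨u, ?_⟩
    rw [h1, map_one]
    change _ = (x ^ n * y - 1) * _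
    linear_combination -M.rel
  -- Here y - 1 = v - (x^n - 1) y, and v divides x - 1 = u v, hence x^n - 1.
  · obtain ⟨c, hc⟩ : x - 1 ∣ x ^ n - 1 := by simpa using sub_dvd_pow_sub_pow x 1 n
    refine ⟨1 - u * c * y, ?_⟩
    rw [h2, map_one]
    change _ = (x ^ n * y - 1) * _
    linear_combination (-y) * hc + c * y * M.rel
  · simp [h3]
  · intro i; fin_cases i <;> simp [special, h1, h2, h3, hX]

theorem exists_line_three (M : IsModification k n x y u) :
    ∃ h : R →ₐ[k] k[X], IsLine n x y u 3 h := by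
  have hX : (1 : k[X]) + X ≠ 0 := by rw [add_comm]; exact X_add_C_ne_zero (1 : k)
  obtain ⟨h, h1, h2, h3⟩ := M.exists_hom 1 (1 + X) 0 (by simp)
  refine ⟨h, ⟨y, ?_⟩, M.dvd_of_hom_eq_zero h (y - 1) _ ?_ ?_ ?_, ?_⟩
  · rw [h2, add_comm, ← C_1, natDegree_X_add_C]; exact one_ne_zero
  · refine ⟨x ^ n * y - 1, ?_⟩
    rw [h1, map_one]
    change _ = u * _
    linear_combination -M.rel
  · simp [h2]
  · simp [special, h3]
  · intro i; fin_cases i <;> simp [special, h1, h2, h3, hX]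

theorem exists_line (M : IsModification k n x y u) (hn : 1 ≤ n) (j : Fin 5) (hj : j ≠ 4) :
    ∃ h : R →ₐ[k] k[X], IsLine n x y u j h := by
  have key : ∀ j : Fin 5, j ≠ 4 → j = 0 ∨ j = 1 ∨ j = 2 ∨ j = 3 := by decide
  obtain rfl | rfl | rfl | rfl := key j hj
  exacts [M.exists_line_zero hn, M.exists_line_one, M.exists_line_two, M.exists_line_three]

/-- Zero would vanish on two of the lines, but each special element vanishes on at most one. -/
theorem special_ne_zero (M : IsModification k n x y u) (hn : 1 ≤ n) (i : Fin 5) :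
    special n x y u i ≠ 0 := by
  intro hi
  obtain ⟨h, h0⟩ := M.exists_line_zero hn
  obtain ⟨h', h1⟩ := M.exists_line_one
  have e0 := (h0.eq_zero_iff i).mp (by rw [hi, map_zero])
  have e1 := (h1.eq_zero_iff i).mp (by rw [hi, map_zero])
  rw [e0] at e1
  exact absurd e1 (by decide)

theorem exists_special_eq_zero (M : IsModification k n x y u) (hn : 1 ≤ n) (h : R →ₐ[k] k[X])
    (hh : ∃ r, (h r).natDegree ≠ 0) :
    ∃ i, h (special n x y u i) = 0 ∧ (2 ≤ n → i ≠ 4) := by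
  by_contra! H
  have H' : ∀ i : Fin 5, i ≠ 4 → h (special n x y u i) ≠ 0 := fun i hi e ↦ hi (H i e).2
  have H4 : h (u * y - 1) ≠ 0 ∨ 2 ≤ n := by
    by_contra! e
    exact absurd (H 4 e.1).1 (by omega)
  have rel := congrArg h M.rel
  have H2 : h (x ^ n * y - 1) ≠ 0 := H' 2 (by decide)
  simp only [map_mul, map_sub, map_pow, map_one] at rel H2 H4
  have hd : (h x).natDegree = 0 ∧ (h y).natDegree = 0 ∧ (h u).natDegree = 0 :=
    deg_eq_zero_of_rel (D := k[X]) (deg := natDegree) (fun _ _ ↦ natDegree_mul)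
      (fun p q ↦ natDegree_sub_le p q) natDegree_one natDegree_zero hn rel
      (H' 0 (by decide)) (H' 1 (by decide)) (H' 3 (by decide)) H2 H4
  have key (r : R) : (h r).natDegree = 0 ↔ r ∈ (⊥ : Subalgebra k k[X]).comap h := by
    rw [Subalgebra.mem_comap, Algebra.mem_bot, natDegree_eq_zero]
    rfl
  simp only [key] at hd
  obtain ⟨r, hr⟩ := hh
  exact hr ((key r).mpr (M.mem_of_gens _ hd.1 hd.2.1 hd.2.2 r))

theorem exists_point (M : IsModification k n x y u) (hn : 1 ≤ n) :
    (∃ e : R →ₐ[k] k, e x = 0 ∧ e y = 0) ∧ (∃ e : R →ₐ[k] k, e y = 0 ∧ e u = 0) ∧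
      ∃ e : R →ₐ[k] k, e u = 0 ∧ e (x ^ n * y - 1) = 0 := by
  have hn0 : n ≠ 0 := by omega
  obtain ⟨h, h1, h2, h3⟩ := M.exists_hom 0 X 1 (by simp [hn0])
  obtain ⟨h', h1', h2', h3'⟩ := M.exists_hom 1 (1 + X) 0 (by simp)
  exact ⟨⟨(aeval 0).comp h, by simp [h1], by simp [h2]⟩,
    ⟨(aeval (-1)).comp h', by simp [h2'], by simp [h3']⟩,
    ⟨(aeval 0).comp h', by simp [h3'], by simp [h1', h2']⟩⟩

end IsModification

/-! ### Presentation and units of B_n -/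

section Instance

variable (k : Type*) [Field k] (n : ℕ)

theorem vars_X_pow_zero_subset : (MvPolynomial.X 0 ^ n : A k).vars ⊆ {0} :=
  (MvPolynomial.vars_pow _ _).trans MvPolynomial.vars_X.subset

theorem prime_denominator : Prime (MvPolynomial.X 0 ^ n * MvPolynomial.X 1 - 1 : A k) := by
  have h : Irreducible (MvPolynomial.X 0 ^ n * MvPolynomial.X 1 + -1 : A k) := by
    refine MvPolynomial.irreducible_mul_X_add _ _ _ (pow_ne_zero _ (MvPolynomial.X_ne_zero _))
      (fun h ↦ ?_) ?_ ?_
    · simpa using vars_X_pow_zero_subset k n h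
    · rw [← map_one MvPolynomial.C, ← map_neg, MvPolynomial.vars_C]; simp
    · exact isUnit_one.neg.isRelPrime_right
  rw [← sub_eq_add_neg] at h
  exact h.prime

theorem not_denominator_dvd :
    ¬ (MvPolynomial.X 0 ^ n * MvPolynomial.X 1 - 1 : A k) ∣ MvPolynomial.X 0 - 1 := by
  rintro ⟨c, hc⟩
  have hX : (RatFunc.X : RatFunc k) ^ n ≠ 0 := pow_ne_zero _ RatFunc.X_ne_zero
  -- On the curve y = x^(-n) the denominator vanishes but x - 1 does not.
  have h := congrArg (MvPolynomial.aeval ![(RatFunc.X : RatFunc k), (RatFunc.X ^ n)⁻¹]) hc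
  have h1 : (RatFunc.X : RatFunc k) - 1 = 0 := by simpa [hX] using h
  rw [← RatFunc.algebraMap_X, ← map_one (algebraMap k[X] (RatFunc k)), ← map_sub,
    FaithfulSMul.algebraMap_eq_zero_iff] at h1
  exact X_sub_C_ne_zero (1 : k) h1

/-- In the fraction field of a domain `S`, the fraction `g / f` with `f` a prime not dividing `g`
satisfies only the multiples of its defining linear equation. -/
theorem dvd_of_aeval_div_eq_zero {S : Type*} [CommRing S] [IsDomain S] {f g : S} (hf : Prime f)
    (hg : ¬ f ∣ g) (p : S[X])
    (hp : aeval (algebraMap S (FractionRing S) g / algebraMap S (FractionRing S) f) p = 0) :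
    C f * X - C g ∣ p := by
  have hf0 : algebraMap S (FractionRing S) f ≠ 0 := by
    simpa using hf.ne_zero
  have hinj := IsFractionRing.injective S (FractionRing S)
  set ξ := algebraMap S (FractionRing S) g / algebraMap S (FractionRing S) f with hξ
  have hfξ : algebraMap S (FractionRing S) f * ξ = algebraMap S (FractionRing S) g :=
    mul_div_cancel₀ _ hf0
  have hlin : aeval ξ (C f * X - C g) = 0 := by simp [hfξ]
  induction hd : p.natDegree using Nat.strong_induction_on generalizing p with
  | _ d ih =>
    obtain rfl | hd0 := Nat.eq_zero_or_pos d
    · obtain ⟨c, rfl⟩ := natDegree_eq_zero.mp hd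
      rw [aeval_C, map_eq_zero_iff _ hinj] at hp
      simp [hp]
    -- Clearing denominators in p(g/f) = 0 leaves only the top term without a factor f. A multiple
    -- of fX - g then cancels the leading term of p.
    have hlead : f ∣ p.leadingCoeff := by
      have h1 : f ∣ p.leadingCoeff * g ^ d := by
        have h2 := scaleRoots_aeval_eq_zero_of_aeval_div_eq_zero hinj hp
          (mem_nonZeroDivisors_of_ne_zero hf.ne_zero)
        rw [aeval_algebraMap_apply, map_eq_zero_iff _ hinj, coe_aeval_eq_eval, eval_eq_sum_range,
          natDegree_scaleRoots, Finset.sum_range_succ, hd, coeff_scaleRoots, hd, Nat.sub_self,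
          pow_zero, mul_one] at h2
        rw [leadingCoeff, hd, ← dvd_add_right (Finset.dvd_sum fun i hi ↦ ?_), h2]
        · exact dvd_zero _
        · rw [coeff_scaleRoots, hd]
          have : d - i ≠ 0 := by have := Finset.mem_range.mp hi; omega
          exact ((dvd_pow_self f this).mul_left _).mul_right _
      exact (hf.dvd_or_dvd h1).resolve_right fun h ↦ hg (hf.dvd_of_dvd_pow h)
    obtain ⟨c, hc⟩ := hlead
    have hlow : (p - (C f * X - C g) * (C c * X ^ (d - 1))).natDegree < d := by
      have hform : (C f * X - C g) * (C c * X ^ (d - 1)) =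
          C (f * c) * X ^ d - C (g * c) * X ^ (d - 1) := by
        obtain ⟨e, rfl⟩ := Nat.exists_eq_add_of_le' hd0
        simp only [C_mul, Nat.add_sub_cancel, pow_succ]
        ring
      have hle : (p - (C f * X - C g) * (C c * X ^ (d - 1))).natDegree ≤ d := by
        rw [hform]
        have h1 := natDegree_sub_le_of_le (natDegree_C_mul_X_pow_le (f * c) d)
          (natDegree_C_mul_X_pow_le (g * c) (d - 1))
        rw [max_eq_left (Nat.sub_le d 1)] at h1
        exact (natDegree_sub_le_of_le hd.le h1).trans_eq (max_self d)
      refine hle.lt_of_ne fun he ↦ ?_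
      have h0 : (p - (C f * X - C g) * (C c * X ^ (d - 1))).leadingCoeff = 0 := by
        rw [leadingCoeff, he, hform, ← hc, leadingCoeff, hd, coeff_sub, coeff_sub, coeff_C_mul_X_pow,
          coeff_C_mul_X_pow, if_pos rfl, if_neg (by omega), sub_zero, sub_self]
      rw [leadingCoeff_eq_zero.mp h0, natDegree_zero] at he
      omega
    have h2 := ih _ hlow _ (by rw [map_sub, map_mul, hlin, hp]; simp) rfl
    exact (dvd_sub_left (dvd_mul_right _ _)).mp h2

theorem u_mem : u k n ∈ B k n := Algebra.subset_adjoin rfl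

theorem exists_aeval_eq (b : B k n) : ∃ p : (A k)[X], aeval (⟨u k n, u_mem k n⟩ : B k n) p = b := by
  obtain ⟨b, hb⟩ := b
  obtain ⟨p, hp⟩ := (Algebra.adjoin_singleton_eq_range_aeval (A k) (u k n)).le hb
  exact ⟨p, Subtype.ext (by simpa [Subalgebra.aeval_coe] using hp)⟩

/-- The kernel of A[T] → B_n is generated by the one relation fT - g, so each solution of it in k[X]
defines a map. -/
theorem exists_hom_B (a b c : k[X]) (habc : c * (a ^ n * b - 1) = a - 1) :
    ∃ h : B k n →ₐ[k] k[X], h (algebraMap (A k) (B k n) (MvPolynomial.X 0)) = a ∧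
      h (algebraMap (A k) (B k n) (MvPolynomial.X 1)) = b ∧
      h (⟨u k n, u_mem k n⟩ : B k n) = c := by
  let F : (A k)[X] →ₐ[k] B k n := (aeval (⟨u k n, u_mem k n⟩ : B k n)).restrictScalars k
  let G : (A k)[X] →ₐ[k] k[X] := aevalTower (MvPolynomial.aeval ![a, b]) c
  have hF : Function.Surjective F := exists_aeval_eq k n
  have hG : RingHom.ker F ≤ RingHom.ker G := by
    intro p hp
    have hp' : aeval (u k n) p = 0 := by
      have := congrArg Subtype.val (show aeval (⟨u k n, u_mem k n⟩ : B k n) p = 0 from hp)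
      simpa [Subalgebra.aeval_coe] using this
    obtain ⟨q, rfl⟩ := dvd_of_aeval_div_eq_zero (prime_denominator k n)
      (not_denominator_dvd k n) p hp'
    rw [RingHom.mem_ker, map_mul]
    have : G (C (MvPolynomial.X 0 ^ n * MvPolynomial.X 1 - 1) * X - C (MvPolynomial.X 0 - 1)) = 0 := by
      simp [G]
      linear_combination habc
    rw [this, zero_mul]
  have key := AlgHom.liftOfSurjective_apply F hF G hG
  refine ⟨AlgHom.liftOfSurjective F hF G hG, ?_, ?_, ?_⟩
  · simpa [F, G] using key (C (MvPolynomial.X 0))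
  · simpa [F, G] using key (C (MvPolynomial.X 1))
  · simpa [F, G] using key X

theorem exists_mul_pow_eq (b : B k n) : ∃ (i : ℕ) (p : A k),
    b * algebraMap (A k) (B k n) (MvPolynomial.X 0 ^ n * MvPolynomial.X 1 - 1) ^ i =
      algebraMap (A k) (B k n) p := by
  have rel : (⟨u k n, u_mem k n⟩ : B k n) *
      algebraMap (A k) (B k n) (MvPolynomial.X 0 ^ n * MvPolynomial.X 1 - 1) =
      algebraMap (A k) (B k n) (MvPolynomial.X 0 - 1) :=
    Subtype.ext (div_mul_cancel₀ _ (denominator_ne_zero k n))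
  obtain ⟨q, rfl⟩ := exists_aeval_eq k n b
  induction q using Polynomial.induction_on' with
  | add p q hp hq =>
    obtain ⟨i, p', hp⟩ := hp
    obtain ⟨j, q', hq⟩ := hq
    set f : A k := MvPolynomial.X 0 ^ n * MvPolynomial.X 1 - 1
    refine ⟨i + j, p' * f ^ j + q' * f ^ i, ?_⟩
    rw [map_add, map_add, map_mul, map_mul, ← hp, ← hq, map_pow, map_pow]
    ring
  | monomial i a =>
    refine ⟨i, a * (MvPolynomial.X 0 - 1) ^ i, ?_⟩
    rw [aeval_monomial, mul_assoc, ← mul_pow, rel, map_mul, map_pow]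

/-- After inverting the prime f, a unit must be a constant times a power of f. The exponent is 0
because f is not a unit of B_n: it vanishes on the line x = y = 1. -/
theorem exists_eq_algebraMap_of_isUnit (b : B k n) (hb : IsUnit b) :
    ∃ c : k, b = algebraMap k (B k n) c := by
  have hinj : Function.Injective (algebraMap (A k) (B k n)) := FaithfulSMul.algebraMap_injective _ _
  obtain ⟨b', hb'⟩ := hb.exists_right_inv
  obtain ⟨i, p, hp⟩ := exists_mul_pow_eq k n b
  obtain ⟨j, q, hq⟩ := exists_mul_pow_eq k n b'
  obtain ⟨h, h1, h2, -⟩ := exists_hom_B k n 1 1 X (by simp)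
  have hf := prime_denominator k n
  have hv : ¬ IsUnit (algebraMap (A k) (B k n)
      (MvPolynomial.X 0 ^ n * MvPolynomial.X 1 - 1)) := fun hu ↦ by
    have := hu.map h
    simp [h1, h2] at this
  set f : A k := MvPolynomial.X 0 ^ n * MvPolynomial.X 1 - 1
  have hpq : p * q = f ^ (i + j) := by
    apply hinj
    rw [map_mul, ← hp, ← hq, map_pow, pow_add]
    linear_combination algebraMap (A k) (B k n) f ^ i * algebraMap (A k) (B k n) f ^ j * hb'
  obtain ⟨l, -, w, hw⟩ := (dvd_prime_pow hf (i + j)).mp (Dvd.intro _ hpq)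
  obtain ⟨c, -, hc⟩ := MvPolynomial.isUnit_iff_eq_C_of_isReduced.mp (w⁻¹).isUnit
  have hpc : p = MvPolynomial.C c * f ^ l := by
    rw [← hc, ← hw]
    linear_combination (-p) * w.mul_inv
  have hcu : IsUnit (algebraMap (A k) (B k n) (MvPolynomial.C c)) := by
    rw [← hc]; exact (w⁻¹).isUnit.map _
  rw [hpc, map_mul, map_pow] at hp
  have hf0 : algebraMap (A k) (B k n) f ≠ 0 := by
    simpa using (map_ne_zero_iff _ hinj).mpr hf.ne_zero
  obtain hil | rfl | hil := lt_trichotomy i l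
  · obtain ⟨e, rfl⟩ := Nat.exists_eq_add_of_lt hil
    refine absurd (isUnit_of_dvd_unit (Dvd.intro_left
      (algebraMap (A k) (B k n) (MvPolynomial.C c) * algebraMap (A k) (B k n) f ^ e) ?_) hb) hv
    apply mul_right_cancel₀ (pow_ne_zero i hf0)
    rw [hp]; ring
  · exact ⟨c, mul_right_cancel₀ (pow_ne_zero i hf0) hp⟩
  · obtain ⟨e, rfl⟩ := Nat.exists_eq_add_of_lt hil
    refine absurd (isUnit_of_dvd_unit (Dvd.intro_left
      (b * algebraMap (A k) (B k n) f ^ e) ?_) hcu) hv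
    apply mul_right_cancel₀ (pow_ne_zero l hf0)
    rw [← hp]; ring

theorem isModification_B : IsModification k n (algebraMap (A k) (B k n) (MvPolynomial.X 0))
    (algebraMap (A k) (B k n) (MvPolynomial.X 1)) (⟨u k n, u_mem k n⟩ : B k n) where
  rel := by
    apply Subtype.ext
    have h := denominator_ne_zero k n
    have h2 := div_mul_cancel₀ (algebraMap (A k) (FractionRing (A k)) (MvPolynomial.X 0 - 1)) h
    simpa [u] using h2
  adjoin_eq_top := by
    rw [eq_top_iff]
    rintro b -
    obtain ⟨p, rfl⟩ := exists_aeval_eq k n b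
    set S := Algebra.adjoin k {algebraMap (A k) (B k n) (MvPolynomial.X 0),
      algebraMap (A k) (B k n) (MvPolynomial.X 1), (⟨u k n, u_mem k n⟩ : B k n)} with hS
    have hA (a : A k) : algebraMap (A k) (B k n) a ∈ S := by
      induction a using MvPolynomial.induction_on with
      | C c =>
        exact S.algebraMap_mem c
      | add p q hp hq => rw [map_add]; exact add_mem hp hq
      | mul_X p i hp =>
        rw [map_mul]
        refine mul_mem hp ?_
        fin_cases i <;> exact Algebra.subset_adjoin (by simp)
    induction p using Polynomial.induction_on' with
    | add p q hp hq => rw [map_add]; exact add_mem hp hq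
    | monomial i a =>
      rw [aeval_monomial]
      exact mul_mem (hA a) (pow_mem (Algebra.subset_adjoin (by simp)) _)
  exists_hom := exists_hom_B k n
  exists_eq_algebraMap := exists_eq_algebraMap_of_isUnit k n

end Instance

/-! ### Isomorphisms and the chain of lines -/

namespace IsModification

variable {k : Type*} [Field k] {m n : ℕ} {R R' : Type*} [CommRing R] [Algebra k R] [CommRing R']
  [Algebra k R'] {x y u : R} {x' y' u' : R'}

theorem IsLine.eq_of_dvd {j l : Fin 5} {h : R →ₐ[k] k[X]} (hl : IsLine m x y u j h)
    (hd : special m x y u j ∣ special m x y u l) : l = j := by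
  obtain ⟨q, hq⟩ := hd
  rw [← hl.eq_zero_iff, hq, map_mul, (hl.eq_zero_iff j).mpr rfl, zero_mul]

/-- Transporting line j to R' puts it in some special zero set i; transporting line i back puts it
in some l. Up to ψ this gives divisibilities from j to i to l, which force l = j and make j and i
associated. -/
theorem exists_map_special_eq [IsDomain R'] (M : IsModification k m x y u) (hm : 1 ≤ m)
    (N : IsModification k n x' y' u') (hn : 2 ≤ n) (ψ : R ≃ₐ[k] R') (j : Fin 5) (hj : j ≠ 4) :
    ∃ i ≠ 4, ∃ c : k, IsUnit c ∧
      ψ (special m x y u j) = algebraMap k R' c * special n x' y' u' i := by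
  obtain ⟨h, hl⟩ := M.exists_line hm j hj
  obtain ⟨r, hr⟩ := hl.nonconstant
  obtain ⟨i, hi, hi4⟩ := N.exists_special_eq_zero (by omega) (h.comp ψ.symm.toAlgHom)
    ⟨ψ r, by simpa using hr⟩
  obtain ⟨h', hl'⟩ := N.exists_line (by omega) i (hi4 hn)
  obtain ⟨r', hr'⟩ := hl'.nonconstant
  obtain ⟨l, hl0, -⟩ := M.exists_special_eq_zero hm (h'.comp ψ.toAlgHom)
    ⟨ψ.symm r', by simpa using hr'⟩
  have d1 : special m x y u j ∣ ψ.symm (special n x' y' u' i) := hl.dvd _ hi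
  have d2 : special n x' y' u' i ∣ ψ (special m x y u l) := hl'.dvd _ hl0
  have d3 : special m x y u j ∣ special m x y u l := by
    refine d1.trans ?_
    simpa using map_dvd ψ.symm d2
  -- This also excludes l = 4, possible a priori when m = 1.
  obtain rfl : l = j := hl.eq_of_dvd d3
  have d4 : ψ (special m x y u l) ∣ special n x' y' u' i := by simpa using map_dvd ψ d1
  obtain ⟨w, hw⟩ := associated_of_dvd_dvd d2 d4
  obtain ⟨c, hc⟩ := N.exists_eq_algebraMap _ w.isUnit
  refine ⟨i, hi4 hn, c, ?_, ?_⟩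
  · rw [isUnit_iff_ne_zero]
    rintro rfl
    exact w.ne_zero (by rw [hc, map_zero])
  · rw [← hw, hc, mul_comm]

/-- Two of the affine lines coincide or are neighbours in the chain they form. -/
def Meet (i j : Fin 5) : Bool :=
  i == j || (i == 0 && j == 1) || (i == 1 && j == 0) || (i == 1 && j == 3) || (i == 3 && j == 1) ||
    (i == 3 && j == 2) || (i == 2 && j == 3)

theorem exists_common_zero (N : IsModification k n x y u) (hn : 1 ≤ n) :
    ∀ i j : Fin 5, i ≠ 4 → j ≠ 4 → Meet i j →
      ∃ e : R →ₐ[k] k, e (special n x y u i) = 0 ∧ e (special n x y u j) = 0 := by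
  obtain ⟨⟨e, e0, e1⟩, ⟨f, f1, f3⟩, ⟨g, g3, g2⟩⟩ := N.exists_point hn
  intro i j hi hj hij
  have key : ∀ i j : Fin 5, i ≠ 4 → j ≠ 4 → Meet i j → ((i = 0 ∨ i = 1) ∧ (j = 0 ∨ j = 1)) ∨
      ((i = 1 ∨ i = 3) ∧ (j = 1 ∨ j = 3)) ∨ ((i = 3 ∨ i = 2) ∧ (j = 3 ∨ j = 2)) := by decide
  obtain ⟨rfl | rfl, rfl | rfl⟩ | ⟨rfl | rfl, rfl | rfl⟩ | ⟨rfl | rfl, rfl | rfl⟩ :=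
    key i j hi hj hij
  exacts [⟨e, e0, e0⟩, ⟨e, e0, e1⟩, ⟨e, e1, e0⟩, ⟨e, e1, e1⟩, ⟨f, f1, f1⟩, ⟨f, f1, f3⟩,
    ⟨f, f3, f1⟩, ⟨f, f3, f3⟩, ⟨g, g3, g3⟩, ⟨g, g3, g2⟩, ⟨g, g2, g3⟩, ⟨g, g2, g2⟩]

/-- In the chain 0, 1, 3, 2, keeping non-neighbours apart allows only the identity and the reversal.
-/
theorem chain_rigid : ∀ i₀ i₁ i₂ i₃ : Fin 5, i₀ ≠ 4 → i₁ ≠ 4 → i₂ ≠ 4 → i₃ ≠ 4 →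
    i₀ ≠ i₁ → i₂ ≠ i₃ → ¬ Meet i₀ i₃ → ¬ Meet i₀ i₂ → ¬ Meet i₂ i₁ →
    (i₀ = 0 ∧ i₁ = 1 ∧ i₂ = 2) ∨ (i₀ = 2 ∧ i₂ = 0 ∧ i₃ = 1) := by
  decide

theorem natDegree_one_sub_X_pow (k : Type*) [Field k] (n : ℕ) :
    ((1 - X : k[X]) ^ n).natDegree = n := by
  rw [natDegree_pow, ← neg_sub, natDegree_neg, ← C_1, natDegree_X_sub_C, mul_one]

theorem eq_of_algEquiv_of_two_le [IsDomain R'] (M : IsModification k m x y u) (hm : 1 ≤ m)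
    (N : IsModification k n x' y' u') (hn : 2 ≤ n) (ψ : R ≃ₐ[k] R') : m = n := by
  have hn1 : 1 ≤ n := by omega
  have hn0 : n ≠ 0 := by omega
  have hm0 : m ≠ 0 := by omega
  have H := M.exists_map_special_eq hm N hn ψ
  have inj (j l : Fin 5) (hj : j ≠ 4) (hjl : l ≠ j) (i i' : Fin 5) (c d : k) (hc : IsUnit c)
      (ej : ψ (special m x y u j) = algebraMap k R' c * special n x' y' u' i)
      (el : ψ (special m x y u l) = algebraMap k R' d * special n x' y' u' i') : i ≠ i' := by
    rintro rfl
    obtain ⟨h, hl⟩ := M.exists_line hm j hj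
    have hd : special m x y u j ∣ special m x y u l := by
      have : ψ (special m x y u j) ∣ ψ (special m x y u l) := by
        rw [ej, el]
        exact ((hc.map (algebraMap k R')).mul_left_dvd.mpr dvd_rfl).trans (dvd_mul_left _ _)
      simpa using map_dvd ψ.symm this
    exact hjl (hl.eq_of_dvd hd)
  have disj (j l : Fin 5) (hjl : ∀ e : R →ₐ[k] k, e (special m x y u j) = 0 →
      e (special m x y u l) ≠ 0) (i i' : Fin 5) (hi : i ≠ 4) (hi' : i' ≠ 4) (c d : k)
      (ej : ψ (special m x y u j) = algebraMap k R' c * special n x' y' u' i)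
      (el : ψ (special m x y u l) = algebraMap k R' d * special n x' y' u' i') : ¬ Meet i i' := by
    intro h
    obtain ⟨e, e1, e2⟩ := N.exists_common_zero hn1 i i' hi hi' h
    exact hjl (e.comp ψ.toAlgHom) (by simp [ej, e1]) (by simp [el, e2])
  obtain ⟨i₀, hi₀, a, ha, e₀⟩ := H 0 (by decide)
  obtain ⟨i₁, hi₁, b, hb, e₁⟩ := H 1 (by decide)
  obtain ⟨i₂, hi₂, c, hc, e₂⟩ := H 2 (by decide)
  obtain ⟨i₃, hi₃, d, hd, e₃⟩ := H 3 (by decide)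
  have rel := M.rel
  have D03 := disj 0 3 (fun e h0 h3 ↦ by
    replace h0 : e x = 0 := h0
    replace h3 : e u = 0 := h3
    have := congrArg e rel
    simp [h0, h3] at this) i₀ i₃ hi₀ hi₃ a d e₀ e₃
  have D02 := disj 0 2 (fun e h0 h2 ↦ by
    replace h0 : e x = 0 := h0
    replace h2 : e (x ^ m * y - 1) = 0 := h2
    simp [h0, hm0] at h2) i₀ i₂ hi₀ hi₂ a c e₀ e₂
  have D21 := disj 2 1 (fun e h2 h1 ↦ by
    replace h1 : e y = 0 := h1
    replace h2 : e (x ^ m * y - 1) = 0 := h2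
    simp [h1] at h2) i₂ i₁ hi₂ hi₁ c b e₂ e₁
  have D01 := inj 0 1 (by decide) (by decide) i₀ i₁ a b ha e₀ e₁
  have D23 := inj 2 3 (by decide) (by decide) i₂ i₃ c d hc e₂ e₃
  have hy0 : y' ≠ 0 := N.special_ne_zero hn1 1
  obtain ⟨h, h1, h2, -⟩ := N.exists_hom 0 X 1 (by simp [hn0])
  obtain ⟨h', h1', -, -⟩ := N.exists_hom (1 - X) 0 X (by ring)
  replace e₀ : ψ x = _ := e₀
  replace e₁ : ψ y = _ := e₁
  replace e₂ : ψ (x ^ m * y - 1) = _ := e₂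
  replace e₃ : ψ u = _ := e₃
  obtain ⟨rfl, rfl, rfl⟩ | ⟨rfl, rfl, rfl⟩ :=
    chain_rigid i₀ i₁ i₂ i₃ hi₀ hi₁ hi₂ hi₃ D01 D23 D03 D02 D21
  · replace e₀ : ψ x = algebraMap k R' a * x' := e₀
    replace e₁ : ψ y = algebraMap k R' b * y' := e₁
    replace e₂ : ψ (x ^ m * y - 1) = algebraMap k R' c * (x' ^ n * y' - 1) := e₂
    rw [map_sub, map_mul, map_pow, map_one, e₀, e₁] at e₂
    -- Restriction to the line x' = 0 fixes the scalar.
    have hc1 : C c = (1 : k[X]) := by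
      have := congrArg h e₂
      simpa [h1, h2, hn0, hm0, eq_comm] using this
    have hc1' : c = 1 := C_injective (by rw [hc1, C_1])
    rw [hc1', map_one, one_mul] at e₂
    have e₄ : algebraMap k R' (a ^ m * b) * x' ^ m = x' ^ n := by
      apply mul_right_cancel₀ hy0
      rw [map_mul, map_pow]
      linear_combination e₂
    -- On the line y' = 0 one has x' = 1 - X, so degrees read off the exponents.
    have e₅ := congrArg (natDegree ∘ h') e₄
    have hab : a ^ m * b ≠ 0 := ((ha.pow m).mul hb).ne_zero
    simp only [Function.comp_apply, map_mul, AlgHom.commutes, map_pow, h1'] at e₅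
    rwa [← map_pow, ← map_mul, ← C_eq_algebraMap, natDegree_C_mul hab, natDegree_one_sub_X_pow,
      natDegree_one_sub_X_pow] at e₅
  -- Reversed chain: u v = x - 1 becomes d c x' y' = a v' - 1, and x' = 0 gives a = -1.
  · replace e₀ : ψ x = algebraMap k R' a * (x' ^ n * y' - 1) := e₀
    replace e₂ : ψ (x ^ m * y - 1) = algebraMap k R' c * x' := e₂
    replace e₃ : ψ u = algebraMap k R' d * y' := e₃
    have e₄ := congrArg ψ rel
    rw [map_mul, e₂, e₃, map_sub, map_one, e₀] at e₄
    have ha1 : C a = (-1 : k[X]) := by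
      have := congrArg h e₄
      simp [h1, h2, hn0] at this
      linear_combination this
    have ha1' : a = -1 := C_injective (by rw [ha1, C_neg, C_1])
    rw [ha1', map_neg, map_one] at e₄
    have e₅ : x' ^ n = algebraMap k R' (-(d * c)) * x' ^ 1 := by
      apply mul_right_cancel₀ hy0
      rw [map_neg, map_mul]
      linear_combination e₄
    have e₆ := congrArg (natDegree ∘ h') e₅
    simp only [Function.comp_apply, map_mul, AlgHom.commutes, map_pow, h1'] at e₆
    rw [← C_eq_algebraMap, natDegree_C_mul (neg_ne_zero.mpr (hd.mul hc).ne_zero),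
      natDegree_one_sub_X_pow, natDegree_one_sub_X_pow] at e₆
    omega

theorem eq_of_algEquiv [IsDomain R] [IsDomain R'] (M : IsModification k m x y u) (hm : 1 ≤ m)
    (N : IsModification k n x' y' u') (hn : 1 ≤ n) (ψ : R ≃ₐ[k] R') : m = n := by
  by_cases h2 : 2 ≤ n
  · exact M.eq_of_algEquiv_of_two_le hm N h2 ψ
  · by_cases h3 : 2 ≤ m
    · exact (N.eq_of_algEquiv_of_two_le hn M h3 ψ.symm).symm
    · omega

/-! ### Cancelling the polynomial variables -/

/-- Every embedding of `B_n` into a polynomial ring over a domain lands in the constants. -/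
theorem exists_eq_C {σ S : Type*} [CommRing S] [IsDomain S] [Algebra k S]
    (M : IsModification k n x y u) (hn : 1 ≤ n) (φ : R →ₐ[k] MvPolynomial σ S)
    (hφ : Function.Injective φ) (r : R) : ∃ s, φ r = MvPolynomial.C s := by
  have H (i : Fin 5) : φ (special n x y u i) ≠ 0 :=
    (map_ne_zero_iff φ hφ).mpr (M.special_ne_zero hn i)
  have rel := congrArg φ M.rel
  have H2 : φ (x ^ n * y - 1) ≠ 0 := H 2
  have H4 : φ (u * y - 1) ≠ 0 := H 4
  simp only [map_mul, map_sub, map_pow, map_one] at rel H2 H4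
  have hd : (φ x).totalDegree = 0 ∧ (φ y).totalDegree = 0 ∧ (φ u).totalDegree = 0 :=
    deg_eq_zero_of_rel (D := MvPolynomial σ S) (deg := MvPolynomial.totalDegree)
      (fun _ _ ↦ MvPolynomial.totalDegree_mul_of_isDomain)
      (fun p q ↦ MvPolynomial.totalDegree_sub p q) MvPolynomial.totalDegree_one
      MvPolynomial.totalDegree_zero hn rel (H 0) (H 1) (H 3) H2 (Or.inl H4)
  have key (r : R) : (∃ s, φ r = MvPolynomial.C s) ↔
      r ∈ (IsScalarTower.toAlgHom k S (MvPolynomial σ S)).range.comap φ := by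
    rw [Subalgebra.mem_comap, AlgHom.mem_range]
    exact exists_congr fun s ↦ eq_comm
  have hC {p : MvPolynomial σ S} (hp : p.totalDegree = 0) : ∃ s, p = MvPolynomial.C s :=
    ⟨_, MvPolynomial.totalDegree_eq_zero_iff_eq_C.mp hp⟩
  rw [key]
  exact M.mem_of_gens _ ((key x).mp (hC hd.1)) ((key y).mp (hC hd.2.1)) ((key u).mp (hC hd.2.2)) r

theorem nonempty_algEquiv [IsDomain R] [IsDomain R'] {σ : Type*} (M : IsModification k m x y u)
    (hm : 1 ≤ m) (N : IsModification k n x' y' u') (hn : 1 ≤ n)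
    (Φ : MvPolynomial σ R ≃ₐ[k] MvPolynomial σ R') : Nonempty (R ≃ₐ[k] R') := by
  let ι : R →ₐ[k] MvPolynomial σ R := IsScalarTower.toAlgHom k R _
  let ι' : R' →ₐ[k] MvPolynomial σ R' := IsScalarTower.toAlgHom k R' _
  let π : MvPolynomial σ R →ₐ[k] R := (MvPolynomial.aeval (fun _ : σ ↦ (0 : R))).restrictScalars k
  let π' : MvPolynomial σ R' →ₐ[k] R' :=
    (MvPolynomial.aeval (fun _ : σ ↦ (0 : R'))).restrictScalars k
  have hπ (r : R) : π (MvPolynomial.C r) = r := MvPolynomial.aeval_C _ _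
  have hπ' (r : R') : π' (MvPolynomial.C r) = r := MvPolynomial.aeval_C _ _
  have h1 (r : R) : ∃ s, Φ (MvPolynomial.C r) = MvPolynomial.C s :=
    M.exists_eq_C hm (Φ.toAlgHom.comp ι) (Φ.injective.comp (MvPolynomial.C_injective σ R)) r
  have h2 (r : R') : ∃ s, Φ.symm (MvPolynomial.C r) = MvPolynomial.C s :=
    N.exists_eq_C hn (Φ.symm.toAlgHom.comp ι')
      (Φ.symm.injective.comp (MvPolynomial.C_injective σ R')) r
  refine ⟨AlgEquiv.ofAlgHom (π'.comp (Φ.toAlgHom.comp ι)) (π.comp (Φ.symm.toAlgHom.comp ι')) ?_ ?_⟩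
  · ext r
    obtain ⟨s, hs⟩ := h2 r
    change π' (Φ (MvPolynomial.C (π (Φ.symm (MvPolynomial.C r))))) = r
    rw [hs, hπ, ← hs, Φ.apply_symm_apply, hπ']
  · ext r
    obtain ⟨s, hs⟩ := h1 r
    change π (Φ.symm (MvPolynomial.C (π' (Φ (MvPolynomial.C r))))) = r
    rw [hs, hπ', ← hs, Φ.symm_apply_apply, hπ]

end IsModification

end AffineModification

theorem corollary4p3 (k : Type*) [Field k] (m n d : ℕ) (hm : 1 ≤ m) (hn : 1 ≤ n) (hd : 1 ≤ d)
    (h : Nonempty (MvPolynomial (Fin d) (AffineModification.B k m) ≃ₐ[k]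
      MvPolynomial (Fin d) (AffineModification.B k n))) :
    m = n := by
  obtain ⟨Φ⟩ := h
  have M := AffineModification.isModification_B k m
  have N := AffineModification.isModification_B k n
  obtain ⟨ψ⟩ := M.nonempty_algEquiv hm N hn Φ
  exact M.eq_of_algEquiv hm N hn ψ
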